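/- Let $k\ge 1$ and let $G$ be a $k$-tree, that is, a finite graph that can be formed from a $(k+1)$-vertex complete graph by adding zero or more vertices one at a time so that, when a vertex is added, its neighbors among the vertices already present form a $k$-vertex clique. An elimination ordering of $G$ is a total ordering of its vertices such that, for each vertex $v$, the neighbors of $v$ that occur later than $v$ form a clique. Let $\mathcal{A}$ be the antimatroid of elimination orderings of $G$: its members are the vertex sets of the prefixes of the elimination orderings of $G$, and its basic words are exactly the elimination orderings of $G$. Then $\mathcal{A}$ contains a double ladder: there are nonempty sequences $X=(x_0,x_1,\dots)$ and $Y=(y_0,y_1,\dots)$ of vertices such that both $(x_0,Y)$ and $(y_0,X)$ are ladders in the set of basic words of $\mathcal{A}$. Here $(x,Y)$ is a ladder if the entries of $Y$ are distinct and different from $x$ and, for every basic word $w$: (1) if $y_i$ occurs earlier than $x$ in $w$, then $y_0,\dots,y_{i-1}$ all occur earlier than $y_i$ in $w$ (so the entries of $Y$ occurring earlier than $x$ form an initial segment of $Y$ and occur in the order of $Y$); and (2) if some entry of $Y$ occurs earlier than $x$ in $w$ and $i$ is the largest index of such an entry, then swapping $x$ and $y_i$ in $w$ gives another basic word. Hence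 $\mathcal{A}$ has a balanced pair, i.e. elements $x,y$ with $\min\{\Pr[x<y],\Pr[y<x]\}\ge\frac13$, where $\Pr[x<y]$ is the probability that $x$ occurs earlier than $y$ in a uniformly random basic word of $\mathcal{A}$. In particular $\mathcal{A}$ is balanced (it has a balanced pair or exactly one basic word). -/

import Mathlib

/-- `x` occurs earlier than `y` in the word `w` (used for elements `x`, `y` of `w`). -/
def Precedes {α : Type*} [DecidableEq α] (w : List α) (x y : α) : Prop :=
  w.idxOf x < w.idxOf y

instance {α : Type*} [DecidableEq α] (w : List α) (x y : α) : Decidable (Precedes w x y) :=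
  inferInstanceAs (Decidable (_ < _))

/-- The orderings of a finite set `S`: all lists that contain every element of `S` exactly once
and nothing else. -/
def orderings {α : Type*} [DecidableEq α] (S : Finset α) : Finset (List α) :=
  ⟨Multiset.lists S.val, Multiset.lists_nodup_finset S⟩

theorem mem_orderings {α : Type*} [DecidableEq α] {S : Finset α} {w : List α} :
    w ∈ orderings S ↔ w.Nodup ∧ w.toFinset = S := by
  have h : w ∈ orderings S ↔ S.val = (w : Multiset α) := Multiset.mem_lists_iff _ _
  rw [h]
  constructor
  · intro h
    have hn : w.Nodup := by
      have := S.nodup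
      rw [h] at this
      exact Multiset.coe_nodup.1 this
    refine ⟨hn, ?_⟩
    ext a
    rw [List.mem_toFinset, ← Finset.mem_val, h, Multiset.mem_coe]
  · rintro ⟨hn, rfl⟩
    rw [List.toFinset_val, List.dedup_eq_self.2 hn]

/-- `(x, Y)` is a ladder in the set `O` of orderings of `S`: `x` is an element of `S`, `Y` is a
sequence of distinct elements of `S` other than `x`, and
* in every ordering of `O`, the elements of `Y` that occur earlier than `x` occur in the order
  given by `Y`: whenever `Y i` with `0 < i` is earlier than `x`, all `Y j` with `j < i` are earlier
  than `Y i`;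
* whenever some elements of `Y` are earlier than `x` in an ordering `w` of `O`, and `i` is the
  largest index of such an element, swapping `x` and `Y i` in `w` gives an ordering in `O`. -/
structure IsLadder {α : Type*} [DecidableEq α] (S : Finset α) (O : Finset (List α))
    (x : α) (Y : List α) : Prop where
  mem : x ∈ S
  subset : ∀ y ∈ Y, y ∈ S
  nodup : Y.Nodup
  notMem : x ∉ Y
  inOrder : ∀ w ∈ O, ∀ (i j : ℕ) (hi : i < Y.length) (hj : j < i),
    Precedes w Y[i] x → Precedes w Y[j] Y[i]
  swap : ∀ w ∈ O, ∀ (i : ℕ) (hi : i < Y.length), Precedes w Y[i] x →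
    (∀ (j : ℕ) (hj : j < Y.length), Precedes w Y[j] x → j ≤ i) →
    w.map (Equiv.swap x Y[i]) ∈ O

/-- The nonempty sequences `X = x₀ :: X'` and `Y = y₀ :: Y'` form a double ladder when `(x₀, Y)`
and `(y₀, X)` are ladders. -/
def HasDoubleLadder {α : Type*} [DecidableEq α] (S : Finset α) (O : Finset (List α)) : Prop :=
  ∃ (x₀ y₀ : α) (X' Y' : List α),
    IsLadder S O x₀ (y₀ :: Y') ∧ IsLadder S O y₀ (x₀ :: X')

/-- `Pr[x < y]` for a uniformly random ordering in `O`. -/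
def prPrecedes {α : Type*} [DecidableEq α] (O : Finset (List α)) (x y : α) : ℚ :=
  ((O.filter fun w => Precedes w x y).card : ℚ) / (O.card : ℚ)

/-- A balanced pair of the set `O` of orderings of `S`. -/
def HasBalancedPair {α : Type*} [DecidableEq α] (S : Finset α) (O : Finset (List α)) : Prop :=
  ∃ x ∈ S, ∃ y ∈ S, 1 / 3 ≤ min (prPrecedes O x y) (prPrecedes O y x)

/-- An antimatroid: a finite family of finite sets that is accessible and closed under unions. -/
structure Antimatroid (α : Type*) [DecidableEq α] where
  sets : Finset (Finset α)
  accessible : ∀ S ∈ sets, S.Nonempty → ∃ x ∈ S, S.erase x ∈ sets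
  union_mem : ∀ S ∈ sets, ∀ T ∈ sets, S ∪ T ∈ sets

namespace Antimatroid

variable {α : Type*} [DecidableEq α]

/-- The elements of an antimatroid are the members of the union of its sets. -/
def elements (A : Antimatroid α) : Finset α := A.sets.biUnion id

/-- The basic words: orderings of the elements all of whose prefixes are members. -/
def basicWords (A : Antimatroid α) : Finset (List α) :=
  (orderings A.elements).filter fun w => ∀ p ∈ w.inits, p.toFinset ∈ A.sets

/-- An antimatroid is balanced if it has a balanced pair or only a single basic word. -/
def IsBalanced (A : Antimatroid α) : Prop :=
  HasBalancedPair A.elements A.basicWords ∨ A.basicWords.card = 1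

end Antimatroid

/-- An elimination ordering of `G`: a total ordering of the vertices such that, for each vertex
`v`, the neighbours of `v` that occur later than `v` form a clique. -/
structure IsEliminationOrdering {V : Type*} [DecidableEq V] (G : SimpleGraph V) (w : List V) :
    Prop where
  nodup : w.Nodup
  complete : ∀ v, v ∈ w
  clique : ∀ v, G.IsClique {u | G.Adj v u ∧ Precedes w v u}

theorem Precedes.of_filter {V : Type*} [DecidableEq V] (P : V → Prop) [DecidablePred P] {u v : V} :
    ∀ {w : List V}, P v → P u → Precedes (w.filter P) v u → Precedes w v u := by
  intro w hv hu
  unfold Precedes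
  induction w with
  | nil => simp
  | cons a l ih =>
    by_cases ha : P a
    · simp only [List.filter_cons, ha, decide_true, if_true, List.idxOf_cons]
      grind
    · simp only [List.filter_cons, ha, decide_false, List.idxOf_cons]
      grind

/-- Eliminating first a prefix `p` of one elimination ordering and then the remaining vertices
in the order of another one gives an elimination ordering. -/
theorem IsEliminationOrdering.merge {V : Type*} [DecidableEq V] {G : SimpleGraph V}
    {p q w : List V} (h : IsEliminationOrdering G (p ++ q)) (h' : IsEliminationOrdering G w) :
    IsEliminationOrdering G (p ++ w.filter (· ∉ p)) := by
  refine ⟨?_, ?_, ?_⟩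
  · have h1 := (List.nodup_append.1 h.nodup).1
    refine List.nodup_append.2 ⟨h1, h'.nodup.filter _, ?_⟩
    intro a ha b hb
    have := List.mem_filter.1 hb
    rintro rfl
    simp_all
  · intro v
    have := h'.complete v
    by_cases hv : v ∈ p <;> simp [*]
  · intro v
    by_cases hv : v ∈ p
    · refine (h.clique v).subset ?_
      rintro u ⟨hu, hlt⟩
      refine ⟨hu, ?_⟩
      unfold Precedes at *
      rw [List.idxOf_append_of_mem hv] at *
      have := List.idxOf_lt_length_of_mem hv
      by_cases hu' : u ∈ p
      · rwa [List.idxOf_append_of_mem hu'] at *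
      · rw [List.idxOf_append_of_notMem hu']
        omega
    · refine (h'.clique v).subset ?_
      rintro u ⟨hu, hlt⟩
      refine ⟨hu, ?_⟩
      unfold Precedes at hlt
      rw [List.idxOf_append_of_notMem hv] at hlt
      by_cases hu' : u ∈ p
      · rw [List.idxOf_append_of_mem hu'] at hlt
        have := List.idxOf_lt_length_of_mem hu'
        omega
      · rw [List.idxOf_append_of_notMem hu'] at hlt
        refine Precedes.of_filter (· ∉ p) hv hu' ?_
        unfold Precedes
        omega

open Classical in
/-- The antimatroid of elimination orderings of `G`: its members are the vertex sets of the
prefixes of the elimination orderings of `G`. -/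
noncomputable def eliminationAntimatroid {V : Type*} [Fintype V] [DecidableEq V]
    (G : SimpleGraph V) : Antimatroid V where
  sets := Finset.univ.filter fun S =>
    ∃ p q : List V, IsEliminationOrdering G (p ++ q) ∧ p.toFinset = S
  accessible := by
    intro S hS hne
    obtain ⟨p, q, h, rfl⟩ := (Finset.mem_filter.1 hS).2
    rcases List.eq_nil_or_concat p with rfl | ⟨l, x, rfl⟩
    · simp at hne
    · rw [List.concat_eq_append] at *
      have hn := (List.nodup_append.1 h.nodup).1
      have hx : x ∉ l := by
        have := (List.nodup_append.1 hn).2.2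
        intro hx
        exact this x hx x (by simp) rfl
      refine ⟨x, by simp, Finset.mem_filter.2 ⟨Finset.mem_univ _, l, [x] ++ q, ?_, ?_⟩⟩
      · rwa [← List.append_assoc]
      · ext a
        simp only [List.mem_toFinset, Finset.mem_erase, List.mem_append, List.mem_singleton]
        grind
  union_mem := by
    intro S hS T hT
    obtain ⟨p, q, h, rfl⟩ := (Finset.mem_filter.1 hS).2
    obtain ⟨p', q', h', rfl⟩ := (Finset.mem_filter.1 hT).2
    have hm := h.merge h'
    rw [List.filter_append, ← List.append_assoc] at hm
    refine Finset.mem_filter.2 ⟨Finset.mem_univ _, _, _, hm, ?_⟩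
    ext a
    simp only [List.mem_toFinset, Finset.mem_union, List.mem_append, List.mem_filter]
    grind

theorem mem_eliminationAntimatroid_sets {V : Type*} [Fintype V] [DecidableEq V]
    {G : SimpleGraph V} {S : Finset V} : S ∈ (eliminationAntimatroid G).sets ↔
      ∃ p q : List V, IsEliminationOrdering G (p ++ q) ∧ p.toFinset = S := by
  simp [eliminationAntimatroid]

/-- The basic words of the antimatroid of elimination orderings are the elimination orderings. -/
theorem mem_basicWords_eliminationAntimatroid {V : Type*} [Fintype V] [DecidableEq V]
    {G : SimpleGraph V} {w : List V} :
    w ∈ (eliminationAntimatroid G).basicWords ↔ IsEliminationOrdering G w := by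
  have hel : ∀ w', IsEliminationOrdering G w' →
      (eliminationAntimatroid G).elements = Finset.univ := by
    intro w' h'
    refine Finset.eq_univ_iff_forall.2 fun v => ?_
    refine Finset.mem_biUnion.2 ⟨w'.toFinset, ?_, by simpa using h'.complete v⟩
    exact mem_eliminationAntimatroid_sets.2 ⟨w', [], by simpa using h', rfl⟩
  simp only [Antimatroid.basicWords, Finset.mem_filter, mem_orderings, List.mem_inits,
    mem_eliminationAntimatroid_sets]
  constructor
  · rintro ⟨⟨hn, hS⟩, hp⟩
    obtain ⟨p₀, q₀, h₀, -⟩ := hp w List.prefix_rfl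
    rw [hel _ h₀] at hS
    refine ⟨hn, fun v => by rw [← List.mem_toFinset, hS]; exact Finset.mem_univ v, fun v => ?_⟩
    have hv : v ∈ w := by rw [← List.mem_toFinset, hS]; exact Finset.mem_univ v
    obtain ⟨a, b, rfl⟩ := List.append_of_mem hv
    have hva : v ∉ a := by
      intro hva
      exact (List.nodup_append.1 hn).2.2 v hva v (by simp) rfl
    obtain ⟨p, q, h, hpa⟩ := hp (a ++ [v]) ⟨b, by simp⟩
    refine (h.clique v).subset ?_
    rintro u ⟨hu, hlt⟩
    refine ⟨hu, ?_⟩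
    have hmem : ∀ z, z ∈ p ↔ z ∈ a ∨ z = v := fun z => by
      rw [← List.mem_toFinset, hpa]; simp [or_comm]
    have huv : u ≠ v := fun e => by subst e; exact G.irrefl hu
    have hup : u ∉ p := by
      intro hup
      rcases (hmem u).1 hup with hua | hua
      · unfold Precedes at hlt
        rw [List.idxOf_append_of_notMem hva, List.idxOf_append_of_mem hua] at hlt
        have := List.idxOf_lt_length_of_mem hua
        omega
      · exact huv hua
    have hvp : v ∈ p := (hmem v).2 (Or.inr rfl)
    unfold Precedes
    rw [List.idxOf_append_of_mem hvp, List.idxOf_append_of_notMem hup]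
    have := List.idxOf_lt_length_of_mem hvp
    omega
  · intro h
    refine ⟨⟨h.nodup, ?_⟩, ?_⟩
    · rw [hel w h]
      exact Finset.eq_univ_iff_forall.2 fun v => by simpa using h.complete v
    · rintro p ⟨q, rfl⟩
      exact ⟨p, q, h, rfl⟩

/-- `IsKTreeOn G k s`: the subgraph of `G` induced by `s` can be formed from a `(k+1)`-vertex
complete graph by adding zero or more vertices `v`, one at a time, such that when `v` is added its
set `t` of neighbours among the vertices already present is a `k`-vertex clique. -/
inductive IsKTreeOn {V : Type*} [DecidableEq V] (G : SimpleGraph V) (k : ℕ) : Finset V → Prop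
  | base {s : Finset V} (hs : G.IsNClique (k + 1) s) : IsKTreeOn G k s
  | add {s t : Finset V} {v : V} (hs : IsKTreeOn G k s) (hv : v ∉ s)
      (ht : ∀ u, u ∈ t ↔ u ∈ s ∧ G.Adj v u) (hclique : G.IsNClique k t) :
      IsKTreeOn G k (insert v s)

/-- A (finite) `k`-tree. -/
def IsKTree {V : Type*} [Fintype V] [DecidableEq V] (G : SimpleGraph V) (k : ℕ) : Prop :=
  IsKTreeOn G k Finset.univ

/-!
In a `k`-tree with more than `k + 1` vertices, deleting a simplicial vertex leaves a `k`-tree, every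
simplicial vertex has exactly `k` neighbours, no two simplicial vertices are adjacent, and there are
at least two of them. Any two of them, `x` and `y`, start a double ladder.

Deleting simplicial vertices other than `x` and `y` for as long as possible leaves a vertex set `U`
whose only simplicial vertices are `x` and `y`
(`IsKTreeOn.exists_forall_isSimplicialIn`). In `U`, keeping `x`, the order in which the other
vertices can be eliminated is forced: deleting `y` makes at most one vertex simplicial, since the
vertices that become simplicial are pairwise adjacent neighbours of `y`. This continues until a
`(k + 1)`-clique around `x` is left (`IsKTreeOn.exists_isForcedChain`), and it gives the sequence
`Y` of a ladder `(x, Y)`. The order condition holds because the first vertex of a set in an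
elimination ordering is simplicial in that set.

For the swap condition, let `u` be the last entry of `Y` before `x`. The vertex `x` can always be
eliminated, and postponing `u` does no harm to `u`, so only a neighbour `z` of `u` between `u` and
`x` could be affected. When `u` is eliminated, its `k` neighbours among the remaining vertices of
`U` are all the neighbours it has left, so `z` lies in `U`. If `Y` had an entry after `u`, then the
next vertex of `U` to be eliminated would be that entry or `x`, hence `x`, although `z` is earlier.
So `u` is the last entry of `Y`, the remaining neighbours of `u` are the neighbours of `x`, and `z`
can still be eliminated at its place after `u` and `x` have changed places
(`IsForcedChain.adj_of_between`). When the graph is complete, any two vertices form a double ladder.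

A double ladder yields a balanced pair by counting. The swaps show that the probability that exactly
`i` entries of `Y` precede `x` does not increase with `i`. If the probability that `x` precedes the
first entry of `Y` is below `1/3`, then so are all these probabilities, and the probability that `x`
precedes `Y[i]`, which is the sum of the first `i + 1` of them, falls between `1/3` and `2/3` for
some `i` (`IsLadder.hasBalancedPair`). Otherwise the other ladder applies, or `x` and `y` themselves
are balanced.
-/

/-! ### Simplicial vertices of `k`-trees -/

open Classical in
/-- The neighbours of `v` in `G` that belong to `s`. -/
noncomputable def nbrsIn {V : Type*} (G : SimpleGraph V) (s : Finset V) (v : V) : Finset V :=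
  s.filter (G.Adj v)

/-- `v` is a simplicial vertex of the subgraph of `G` induced by `s`. -/
def IsSimplicialIn {V : Type*} (G : SimpleGraph V) (s : Finset V) (v : V) : Prop :=
  v ∈ s ∧ G.IsClique (nbrsIn G s v : Set V)

theorem mem_nbrsIn {V : Type*} {G : SimpleGraph V} {s : Finset V} {u v : V} :
    u ∈ nbrsIn G s v ↔ u ∈ s ∧ G.Adj v u := by
  simp [nbrsIn]

theorem nbrsIn_mono {V : Type*} {G : SimpleGraph V} {s t : Finset V} (h : s ⊆ t) (v : V) :
    nbrsIn G s v ⊆ nbrsIn G t v := fun _ hu =>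
  mem_nbrsIn.2 ⟨h (mem_nbrsIn.1 hu).1, (mem_nbrsIn.1 hu).2⟩

namespace IsSimplicialIn

variable {V : Type*} {G : SimpleGraph V} {s t : Finset V} {u v w : V}

theorem mono (h : IsSimplicialIn G s v) (hts : t ⊆ s) (hv : v ∈ t) : IsSimplicialIn G t v :=
  ⟨hv, h.2.subset (by exact_mod_cast nbrsIn_mono hts v)⟩

theorem adj (h : IsSimplicialIn G s v) (hu : u ∈ s) (hw : w ∈ s) (hvu : G.Adj v u)
    (hvw : G.Adj v w) (huw : u ≠ w) : G.Adj u w :=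
  h.2 (mem_nbrsIn.2 ⟨hu, hvu⟩) (mem_nbrsIn.2 ⟨hw, hvw⟩) huw

/-- Adding a non-neighbour of `v` does not change whether `v` is simplicial. -/
theorem of_erase [DecidableEq V] (h : IsSimplicialIn G (s.erase u) v) (huv : ¬ G.Adj v u) :
    IsSimplicialIn G s v := by
  refine ⟨Finset.mem_of_mem_erase h.1, h.2.subset ?_⟩
  intro z hz
  obtain ⟨hz, hvz⟩ := mem_nbrsIn.1 hz
  refine mem_nbrsIn.2 ⟨Finset.mem_erase.2 ⟨?_, hz⟩, hvz⟩
  rintro rfl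
  exact huv hvz

theorem isClique_neighborSet [Fintype V] (h : IsSimplicialIn G Finset.univ v) :
    G.IsClique (G.neighborSet v) :=
  h.2.subset fun u hu => mem_nbrsIn.2 ⟨Finset.mem_univ u, hu⟩

end IsSimplicialIn

namespace IsKTreeOn

variable {V : Type*} [DecidableEq V] {G : SimpleGraph V} {k : ℕ} {s : Finset V}

theorem lt_card (h : IsKTreeOn G k s) : k + 1 ≤ s.card := by
  induction h with
  | base hs => exact hs.card_eq.ge
  | add hs hv ht hc ih => rw [Finset.card_insert_of_notMem hv]; omega

theorem isClique_of_card (h : IsKTreeOn G k s) (hs : s.card = k + 1) : G.IsClique (s : Set V) := by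
  cases h with
  | base hs => exact hs.isClique
  | add h' hv ht hc =>
    have := h'.lt_card
    rw [Finset.card_insert_of_notMem hv] at hs
    omega

theorem le_card_nbrsIn (h : IsKTreeOn G k s) {v : V} (hv : v ∈ s) :
    k ≤ (nbrsIn G s v).card := by
  induction h with
  | @base s hs =>
    have : s.erase v ⊆ nbrsIn G s v := fun u hu => mem_nbrsIn.2
      ⟨Finset.mem_of_mem_erase hu, hs.isClique hv (Finset.mem_of_mem_erase hu)
        (Finset.ne_of_mem_erase hu).symm⟩
    have h1 := Finset.card_le_card this
    rw [Finset.card_erase_of_mem hv, hs.card_eq] at h1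
    omega
  | @add s t u hs hu ht hc ih =>
    rcases Finset.mem_insert.1 hv with rfl | hv
    · rw [← hc.card_eq]
      exact Finset.card_le_card fun z hz => mem_nbrsIn.2
        ⟨Finset.mem_insert_of_mem ((ht z).1 hz).1, ((ht z).1 hz).2⟩
    · exact (ih hv).trans (Finset.card_le_card (nbrsIn_mono (Finset.subset_insert _ _) v))

theorem card_le_of_isClique (h : IsKTreeOn G k s) {c : Finset V} (hcs : c ⊆ s)
    (hc : G.IsClique (c : Set V)) : c.card ≤ k + 1 := by
  induction h generalizing c with
  | base hs => exact (Finset.card_le_card hcs).trans hs.card_eq.le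
  | @add s t u hs hu ht htc ih =>
    by_cases huc : u ∈ c
    · have : c ⊆ insert u t := by
        intro z hz
        by_cases hzu : z = u
        · simp [hzu]
        · refine Finset.mem_insert_of_mem ((ht z).2 ⟨?_, hc huc hz (Ne.symm hzu)⟩)
          exact (Finset.mem_insert.1 (hcs hz)).resolve_left hzu
      exact (Finset.card_le_card this).trans
        ((Finset.card_insert_le _ _).trans (by rw [htc.card_eq]))
    · exact ih ((Finset.subset_insert_iff_of_notMem huc).1 hcs) hc

theorem card_nbrsIn (h : IsKTreeOn G k s) {v : V} (hv : IsSimplicialIn G s v) :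
    (nbrsIn G s v).card = k := by
  refine le_antisymm ?_ (h.le_card_nbrsIn hv.1)
  have hn : v ∉ nbrsIn G s v := fun hm => G.irrefl (mem_nbrsIn.1 hm).2
  have := h.card_le_of_isClique (c := insert v (nbrsIn G s v))
    (Finset.insert_subset hv.1 fun u hu => (mem_nbrsIn.1 hu).1) (by
      rw [Finset.coe_insert]
      exact hv.2.insert fun u hu _ => (mem_nbrsIn.1 hu).2)
  rw [Finset.card_insert_of_notMem hn] at this
  omega

theorem erase (h : IsKTreeOn G k s) {v : V} (hv : IsSimplicialIn G s v) (hs : k + 1 < s.card) :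
    IsKTreeOn G k (s.erase v) := by
  induction h with
  | base hc => exact absurd hc.card_eq hs.ne'
  | @add s t u h' hu ht htc ih =>
    by_cases hvu : v = u
    · rwa [hvu, Finset.erase_insert hu]
    have hvs : v ∈ s := (Finset.mem_insert.1 hv.1).resolve_left hvu
    have hv' : IsSimplicialIn G s v := hv.mono (Finset.subset_insert _ _) hvs
    -- If `v` were adjacent to `u`, it would have `u` and `k` older vertices as neighbours.
    have huv : ¬ G.Adj u v := by
      intro huv
      have h1 : insert u (nbrsIn G s v) ⊆ nbrsIn G (insert u s) v := by
        refine Finset.insert_subset (mem_nbrsIn.2 ⟨Finset.mem_insert_self _ _, huv.symm⟩)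
          (nbrsIn_mono (Finset.subset_insert _ _) v)
      have h2 := Finset.card_le_card h1
      rw [Finset.card_insert_of_notMem (fun hm => hu (mem_nbrsIn.1 hm).1),
        (IsKTreeOn.add h' hu ht htc).card_nbrsIn hv, h'.card_nbrsIn hv'] at h2
      omega
    rw [Finset.erase_insert_of_ne (Ne.symm hvu)]
    have ht' : ∀ z, z ∈ t ↔ z ∈ s.erase v ∧ G.Adj u z := by
      intro z
      rw [ht z, Finset.mem_erase]
      constructor
      · rintro ⟨hz, huz⟩
        exact ⟨⟨fun e => huv (e ▸ huz), hz⟩, huz⟩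
      · rintro ⟨⟨-, hz⟩, huz⟩
        exact ⟨hz, huz⟩
    rcases h'.lt_card.eq_or_lt with hcard | hcard
    · have hts : t = s.erase v := by
        refine Finset.eq_of_subset_of_card_le (fun z hz => ((ht' z).1 hz).1) ?_
        rw [Finset.card_erase_of_mem hvs, htc.card_eq, ← hcard]
        omega
      rw [← hts]
      refine .base (htc.insert fun z hz => ((ht z).1 hz).2)
    · exact .add (ih hv' hcard) (fun hm => hu (Finset.mem_of_mem_erase hm)) ht' htc

/-- Two adjacent simplicial vertices have the same closed neighbourhood, so that deleting one of
them would leave the other with fewer than `k` neighbours. -/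
theorem not_adj (h : IsKTreeOn G k s) (hs : k + 1 < s.card) {u v : V}
    (hu : IsSimplicialIn G s u) (hv : IsSimplicialIn G s v) : ¬ G.Adj u v := by
  intro huv
  have h1 := (h.erase hu hs).le_card_nbrsIn (v := v) (Finset.mem_erase.2 ⟨huv.ne', hv.1⟩)
  have h2 : insert u (nbrsIn G (s.erase u) v) ⊆ nbrsIn G s v :=
    Finset.insert_subset (mem_nbrsIn.2 ⟨hu.1, huv.symm⟩) (nbrsIn_mono (Finset.erase_subset _ _) v)
  have h3 := Finset.card_le_card h2
  rw [Finset.card_insert_of_notMem (fun hm => by simpa using (mem_nbrsIn.1 hm).1),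
    h.card_nbrsIn hv] at h3
  omega

theorem exists_isSimplicialIn (h : IsKTreeOn G k s) (hs : k + 1 < s.card) :
    ∃ u v, u ≠ v ∧ IsSimplicialIn G s u ∧ IsSimplicialIn G s v := by
  induction h with
  | base hc => exact absurd hc.card_eq hs.ne'
  | @add s t u h' hu ht htc ih =>
    have hsu : IsSimplicialIn G (insert u s) u := by
      refine ⟨Finset.mem_insert_self _ _, htc.isClique.subset ?_⟩
      intro z hz
      obtain ⟨hz, huz⟩ := mem_nbrsIn.1 hz
      exact (ht z).2 ⟨(Finset.mem_insert.1 hz).resolve_left huz.ne', huz⟩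
    have key : ∀ z, z ∉ t → IsSimplicialIn G s z →
        ∃ a b, a ≠ b ∧ IsSimplicialIn G (insert u s) a ∧ IsSimplicialIn G (insert u s) b := by
      intro z hzt hz
      refine ⟨u, z, fun e => hu (e ▸ hz.1), hsu, ?_⟩
      refine IsSimplicialIn.of_erase (u := u) (by rwa [Finset.erase_insert hu]) fun hzu => ?_
      exact hzt ((ht z).2 ⟨hz.1, hzu.symm⟩)
    rcases h'.lt_card.eq_or_lt with hcard | hcard
    · obtain ⟨z, hz, hzt⟩ := Finset.exists_mem_notMem_of_card_lt_card
        (show t.card < s.card by rw [htc.card_eq]; omega)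
      exact key z hzt ⟨hz, (h'.isClique_of_card hcard.symm).subset
        fun y hy => (mem_nbrsIn.1 hy).1⟩
    · obtain ⟨a, b, hab, ha, hb⟩ := ih hcard
      by_cases hat : a ∈ t
      · refine key b (fun hbt => ?_) hb
        exact h'.not_adj hcard ha hb (htc.isClique hat hbt hab)
      · exact key a hat ha

theorem exists_isEliminationOrdering_on (h : IsKTreeOn G k s) :
    ∃ w : List V, w.Nodup ∧ (∀ v, v ∈ w ↔ v ∈ s) ∧
      ∀ v, G.IsClique {u | u ∈ s ∧ G.Adj v u ∧ Precedes w v u} := by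
  induction h with
  | @base s hs =>
    exact ⟨s.toList, s.nodup_toList, fun v => Finset.mem_toList,
      fun v => hs.isClique.subset fun u hu => hu.1⟩
  | @add s t u h' hu ht htc ih =>
    obtain ⟨w, hn, hw, hc⟩ := ih
    refine ⟨u :: w, List.nodup_cons.2 ⟨fun hm => hu ((hw u).1 hm), hn⟩, by simp [hw], fun v => ?_⟩
    by_cases hvu : v = u
    · subst hvu
      refine htc.isClique.subset ?_
      rintro z ⟨hz, hvz, -⟩
      exact (ht z).2 ⟨(Finset.mem_insert.1 hz).resolve_left hvz.ne', hvz⟩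
    · refine (hc v).subset ?_
      rintro z ⟨hz, hvz, hp⟩
      have hzu : z ≠ u := by
        rintro rfl
        simp [Precedes] at hp
      refine ⟨(Finset.mem_insert.1 hz).resolve_left hzu, hvz, ?_⟩
      unfold Precedes at *
      rw [List.idxOf_cons_ne _ (Ne.symm hvu), List.idxOf_cons_ne _ (Ne.symm hzu)] at hp
      omega

end IsKTreeOn

theorem IsKTree.exists_isEliminationOrdering {V : Type*} [Fintype V] [DecidableEq V]
    {G : SimpleGraph V} {k : ℕ} (h : IsKTree G k) : ∃ w, IsEliminationOrdering G w := by
  obtain ⟨w, hn, hw, hc⟩ := h.exists_isEliminationOrdering_on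
  exact ⟨w, hn, by simpa using hw, by simpa using hc⟩

/-! ### A double ladder gives a balanced pair -/

theorem precedes_map_swap {α : Type*} [DecidableEq α] (w : List α) (x y a b : α) :
    Precedes (w.map (Equiv.swap x y)) a b ↔
      Precedes w (Equiv.swap x y a) (Equiv.swap x y b) := by
  have h (c : α) : (w.map (Equiv.swap x y)).idxOf c = w.idxOf (Equiv.swap x y c) := by
    induction w with
    | nil => simp
    | cons d l ih =>
      rw [List.map_cons, List.idxOf_cons, List.idxOf_cons, ih]
      have : (Equiv.swap x y d == c) = (d == Equiv.swap x y c) := by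
        rw [Bool.eq_iff_iff, beq_iff_eq, beq_iff_eq, Equiv.swap_apply_eq_iff]
      rw [this]
  simp [Precedes, h]

theorem Precedes.trans {α : Type*} [DecidableEq α] {w : List α} {x y z : α}
    (h : Precedes w x y) (h' : Precedes w y z) : Precedes w x z :=
  lt_trans h h'

theorem Precedes.asymm {α : Type*} [DecidableEq α] {w : List α} {x y : α}
    (h : Precedes w x y) : ¬ Precedes w y x :=
  lt_asymm h

theorem Precedes.ne {α : Type*} [DecidableEq α] {w : List α} {x y : α}
    (h : Precedes w x y) : x ≠ y := by
  rintro rfl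
  exact lt_irrefl _ h

theorem not_precedes_iff {α : Type*} [DecidableEq α] {w : List α} {x y : α} (hx : x ∈ w)
    (hxy : x ≠ y) : ¬ Precedes w x y ↔ Precedes w y x := by
  unfold Precedes
  rw [not_lt]
  refine ⟨fun h => lt_of_le_of_ne h fun e => hxy ?_, le_of_lt⟩
  exact (List.idxOf_inj hx).1 e.symm

section Balanced

variable {α : Type*} [DecidableEq α] {S : Finset α} {O : Finset (List α)}

theorem mem_of_mem_orderings (hO : O ⊆ orderings S) {w : List α} (hw : w ∈ O) {x : α}
    (hx : x ∈ S) : x ∈ w := by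
  rw [← List.mem_toFinset, (mem_orderings.1 (hO hw)).2]
  exact hx

theorem card_filter_precedes_add (hO : O ⊆ orderings S) {x y : α} (hx : x ∈ S) (hxy : x ≠ y) :
    (O.filter fun w => Precedes w x y).card + (O.filter fun w => Precedes w y x).card = O.card := by
  rw [← Finset.card_filter_add_card_filter_not (s := O) (fun w => Precedes w x y)]
  congr 2
  refine Finset.filter_congr fun w hw => ?_
  rw [not_precedes_iff (mem_of_mem_orderings hO hw hx) hxy]

theorem one_third_le_prPrecedes (hne : O.Nonempty) {x y : α}
    (h : O.card ≤ 3 * (O.filter fun w => Precedes w x y).card) : 1 / 3 ≤ prPrecedes O x y := by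
  have h0 : (0 : ℚ) < O.card := by exact_mod_cast hne.card_pos
  have h' : (O.card : ℚ) ≤ 3 * ((O.filter fun w => Precedes w x y).card : ℚ) := by exact_mod_cast h
  rw [prPrecedes, le_div_iff₀ h0]
  linarith

namespace IsLadder

variable {x : α} {Y : List α}

/-- Since the entries of `Y` before `x` form an initial segment, `Y[i]` is the last of them as
soon as `Y[i + 1]` is not among them. -/
theorem swap_mem (h : IsLadder S O x Y) {w : List α} (hw : w ∈ O) {i : ℕ}
    (hi : i < Y.length) (hix : Precedes w Y[i] x)
    (hnext : ∀ hi' : i + 1 < Y.length, Precedes w x Y[i + 1]) :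
    w.map (Equiv.swap x Y[i]) ∈ O := by
  refine h.swap w hw i hi hix fun j hj hjx => ?_
  by_contra! hij
  have hi' : i + 1 < Y.length := by omega
  rcases (Nat.succ_le_of_lt hij).eq_or_lt with e | hlt
  · subst e
    exact hjx.asymm (hnext hi')
  · exact ((h.inOrder w hw j (i + 1) hj hlt hjx).trans hjx).asymm (hnext hi')

/-- The number of words in which exactly the first `i` entries of `Y` precede `x` does not
increase with `i`, since swapping `x` with the last entry of `Y` before it is injective. -/
theorem card_le (h : IsLadder S O x Y) {i : ℕ} (hi : i < Y.length) :
    (O.filter fun w => Precedes w Y[i] x ∧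
        ∀ hi' : i + 1 < Y.length, Precedes w x Y[i + 1]).card ≤
      (O.filter fun w => (∀ hi0 : 0 < i, Precedes w Y[i - 1] x) ∧ Precedes w x Y[i]).card := by
  have hne (j : ℕ) (hj : j < Y.length) : Y[j] ≠ x := fun e => h.notMem (e ▸ List.getElem_mem hj)
  refine Finset.card_le_card_of_injOn (fun w => w.map (Equiv.swap x Y[i])) ?_ ?_
  · intro w hw
    obtain ⟨hw, hix, hnext⟩ := Finset.mem_filter.1 hw
    refine Finset.mem_filter.2 ⟨h.swap_mem hw hi hix hnext, fun hi0 => ?_, ?_⟩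
    · have h1 : Y[i - 1] ≠ Y[i] := fun e => by
        have := h.nodup.getElem_inj_iff.1 e
        omega
      rw [precedes_map_swap, Equiv.swap_apply_of_ne_of_ne (hne _ _) h1, Equiv.swap_apply_left]
      exact h.inOrder w hw i (i - 1) hi (by omega) hix
    · rw [precedes_map_swap, Equiv.swap_apply_left, Equiv.swap_apply_right]
      exact hix
  · intro w _ w' _ e
    exact (List.map_injective_iff.2 (Equiv.injective _)) e

/-- If `x` rarely precedes the first entry of `Y`, then the probabilities that `x` precedes the
successive entries of `Y` increase from below `1/3` to above `2/3` in steps below `1/3`. -/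
theorem hasBalancedPair (h : IsLadder S O x Y) (hO : O ⊆ orderings S) (hY : 0 < Y.length)
    (hlt : 3 * (O.filter fun w => Precedes w x Y[0]).card < O.card) : HasBalancedPair S O := by
  have hne (j : ℕ) (hj : j < Y.length) : x ≠ Y[j] := fun e => h.notMem (e ▸ List.getElem_mem hj)
  -- `d i` counts the words in which exactly the first `i` entries of `Y` precede `x`.
  let d (i : ℕ) : ℕ := (O.filter fun w => (∀ h0 : 0 < i ∧ i - 1 < Y.length,
    Precedes w Y[i - 1] x) ∧ ∀ h1 : i < Y.length, Precedes w x Y[i]).card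
  have hd (i : ℕ) (hi : i ≤ Y.length) : 3 * d i < O.card := by
    induction i with
    | zero =>
      refine lt_of_le_of_lt (Nat.mul_le_mul_left 3 (Finset.card_le_card ?_)) hlt
      intro w hw
      obtain ⟨hw, -, h1⟩ := Finset.mem_filter.1 hw
      exact Finset.mem_filter.2 ⟨hw, h1 hY⟩
    | succ i ih =>
      refine lt_of_le_of_lt (Nat.mul_le_mul_left 3 ?_) (ih (by omega))
      refine le_trans (Finset.card_le_card ?_)
        ((h.card_le (i := i) (by omega)).trans (Finset.card_le_card ?_))
      · intro w hw
        obtain ⟨hw, h0, h1⟩ := Finset.mem_filter.1 hw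
        exact Finset.mem_filter.2 ⟨hw, h0 ⟨by omega, by omega⟩, h1⟩
      · intro w hw
        obtain ⟨hw, h0, h1⟩ := Finset.mem_filter.1 hw
        exact Finset.mem_filter.2 ⟨hw, fun h2 => h0 h2.1, fun _ => h1⟩
  -- Every step of the cumulative counts is bounded by one of the `d i`.
  have hstep (i : ℕ) (hi : i + 1 < Y.length) :
      (O.filter fun w => Precedes w x Y[i + 1]).card ≤
        (O.filter fun w => Precedes w x Y[i]).card + d (i + 1) := by
    refine le_trans (Finset.card_le_card ?_) (Finset.card_union_le _ _)
    intro w hw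
    obtain ⟨hw, h1⟩ := Finset.mem_filter.1 hw
    rw [Finset.mem_union, Finset.mem_filter, Finset.mem_filter]
    by_cases h2 : Precedes w x Y[i]
    · exact Or.inl ⟨hw, h2⟩
    · exact Or.inr ⟨hw, fun _ => (not_precedes_iff
        (mem_of_mem_orderings hO hw h.mem) (hne _ _)).1 h2, fun _ => h1⟩
  have hlast : (O.filter fun w => Precedes w Y[Y.length - 1] x).card ≤ d Y.length := by
    refine Finset.card_le_card fun w hw => ?_
    obtain ⟨hw, h1⟩ := Finset.mem_filter.1 hw
    exact Finset.mem_filter.2 ⟨hw, fun _ => h1, fun h2 => absurd h2 (lt_irrefl _)⟩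
  have hsum (i : ℕ) (hi : i < Y.length) := card_filter_precedes_add hO h.mem (hne i hi)
  have hex : ∃ i, ∃ hi : i < Y.length,
      O.card ≤ 3 * (O.filter fun w => Precedes w x Y[i]).card := by
    refine ⟨Y.length - 1, by omega, ?_⟩
    have h1 := hsum (Y.length - 1) (by omega)
    have h2 := hd Y.length le_rfl
    omega
  classical
  obtain ⟨hi, hle⟩ := Nat.find_spec hex
  have hmin := fun j (hj : j < Nat.find hex) => Nat.find_min hex hj
  generalize Nat.find hex = i at hi hle hmin
  have hne' : O.Nonempty := Finset.card_pos.1 (by omega)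
  refine ⟨x, h.mem, Y[i], h.subset _ (List.getElem_mem hi), le_min
    (one_third_le_prPrecedes hne' hle) (one_third_le_prPrecedes hne' ?_)⟩
  cases i with
  | zero => omega
  | succ i =>
    have h1 : ¬ O.card ≤ 3 * (O.filter fun w => Precedes w x Y[i]).card := fun hc =>
      hmin i (by omega) ⟨by omega, hc⟩
    have h2 := hstep i hi
    have h3 := hd (i + 1) hi.le
    have h4 := hsum (i + 1) hi
    omega

end IsLadder

theorem HasDoubleLadder.hasBalancedPair (h : HasDoubleLadder S O) (hO : O ⊆ orderings S)
    (hne : O.Nonempty) : HasBalancedPair S O := by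
  obtain ⟨x, y, X, Y, hx, hy⟩ := h
  by_cases h1 : 3 * (O.filter fun w => Precedes w x y).card < O.card
  · exact hx.hasBalancedPair hO (by simp) (by simpa using h1)
  by_cases h2 : 3 * (O.filter fun w => Precedes w y x).card < O.card
  · exact hy.hasBalancedPair hO (by simp) (by simpa using h2)
  exact ⟨x, hx.mem, y, hy.mem, le_min (one_third_le_prPrecedes hne (not_lt.1 h1))
    (one_third_le_prPrecedes hne (not_lt.1 h2))⟩

end Balanced

/-! ### Forced chains -/

/-- `IsForcedChain G k x U Y`: the subgraph of `G` induced by `U` is a `k`-tree in which, as long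
as `x` is kept, the only way of deleting simplicial vertices one at a time is to delete the entries
of `Y` in this order, and what remains then is a `(k+1)`-vertex clique that contains `x`. -/
inductive IsForcedChain {V : Type*} [DecidableEq V] (G : SimpleGraph V) (k : ℕ) (x : V) :
    Finset V → List V → Prop
  | nil {U : Finset V} (hU : G.IsNClique (k + 1) U) (hx : x ∈ U) : IsForcedChain G k x U []
  | cons {U : Finset V} {y : V} {Y : List V} (hU : IsKTreeOn G k U) (hcard : k + 1 < U.card)
      (hxy : x ≠ y) (hx : IsSimplicialIn G U x) (hy : IsSimplicialIn G U y)
      (h : ∀ v, IsSimplicialIn G U v → v = x ∨ v = y) (hY : IsForcedChain G k x (U.erase y) Y) :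
      IsForcedChain G k x U (y :: Y)

section Chains

variable {V : Type*} [DecidableEq V] {G : SimpleGraph V} {k : ℕ}

/-- Deleting simplicial vertices other than the nonadjacent simplicial vertices `x` and `y` for as
long as possible leaves a `k`-tree in which `x` and `y` are the only simplicial vertices. -/
theorem IsKTreeOn.exists_forall_isSimplicialIn {s : Finset V} (h : IsKTreeOn G k s)
    {x y : V} (hxy : x ≠ y) (hadj : ¬ G.Adj x y) (hx : IsSimplicialIn G s x)
    (hy : IsSimplicialIn G s y) : ∃ U, IsKTreeOn G k U ∧ k + 1 < U.card ∧
      IsSimplicialIn G U x ∧ IsSimplicialIn G U y ∧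
      ∀ v, IsSimplicialIn G U v → v = x ∨ v = y := by
  induction hn : s.card generalizing s with
  | zero => have := h.lt_card; omega
  | succ n ih =>
    have hcard : k + 1 < s.card := lt_of_le_of_ne h.lt_card fun e =>
      hadj (h.isClique_of_card e.symm hx.1 hy.1 hxy)
    by_cases hall : ∀ v, IsSimplicialIn G s v → v = x ∨ v = y
    · exact ⟨s, h, hcard, hx, hy, hall⟩
    · push Not at hall
      obtain ⟨v, hv, hvx, hvy⟩ := hall
      refine ih (h.erase hv hcard)
        (hx.mono (Finset.erase_subset _ _) (Finset.mem_erase.2 ⟨hvx.symm, hx.1⟩))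
        (hy.mono (Finset.erase_subset _ _) (Finset.mem_erase.2 ⟨hvy.symm, hy.1⟩)) ?_
      rw [Finset.card_erase_of_mem hv.1, hn]
      rfl

theorem IsKTreeOn.exists_isForcedChain {U : Finset V} (h : IsKTreeOn G k U) (hcard : k + 1 < U.card)
    {x y : V} (hxy : x ≠ y) (hx : IsSimplicialIn G U x) (hy : IsSimplicialIn G U y)
    (hall : ∀ v, IsSimplicialIn G U v → v = x ∨ v = y) :
    ∃ Y, IsForcedChain G k x U (y :: Y) := by
  induction hn : U.card generalizing U y with
  | zero => omega
  | succ n ih =>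
    have hU' := h.erase hy hcard
    have hx' : IsSimplicialIn G (U.erase y) x :=
      hx.mono (Finset.erase_subset _ _) (Finset.mem_erase.2 ⟨hxy, hx.1⟩)
    rcases hU'.lt_card.eq_or_lt with hc | hc
    · exact ⟨[], .cons h hcard hxy hx hy hall
        (.nil ⟨hU'.isClique_of_card hc.symm, hc.symm⟩ hx'.1)⟩
    · have hex : ∃ z, IsSimplicialIn G (U.erase y) z ∧ x ≠ z := by
        obtain ⟨a, b, hab, ha, hb⟩ := hU'.exists_isSimplicialIn hc
        by_cases hxa : x = a
        · exact ⟨b, hb, fun e => hab (hxa.symm.trans e)⟩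
        · exact ⟨a, ha, hxa⟩
      obtain ⟨z, hz, hxz⟩ := hex
      -- A vertex that becomes simplicial when `y` is deleted is a neighbour of `y`.
      have hnew (v : V) (hv : IsSimplicialIn G (U.erase y) v) (hvx : v ≠ x) : G.Adj y v := by
        by_contra hyv
        rcases hall v (hv.of_erase fun e => hyv e.symm) with e | e
        · exact hvx e
        · exact Finset.ne_of_mem_erase hv.1 e
      obtain ⟨Y, hY⟩ := ih hU' hc hxz hx' hz (fun v hv => by
        by_contra! hcon
        refine hU'.not_adj hc hv hz ?_
        exact hy.adj (Finset.mem_of_mem_erase hv.1) (Finset.mem_of_mem_erase hz.1)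
          (hnew v hv hcon.1) (hnew z hz hxz.symm) hcon.2) (by
        rw [Finset.card_erase_of_mem hy.1, hn]
        rfl)
      exact ⟨z :: Y, .cons h hcard hxy hx hy hall hY⟩

/-- The first vertex of `U` in an elimination ordering is a simplicial vertex of `U`. -/
theorem IsEliminationOrdering.exists_first {w : List V} (hw : IsEliminationOrdering G w)
    {U : Finset V} (hU : U.Nonempty) :
    ∃ v, IsSimplicialIn G U v ∧ ∀ u ∈ U, u ≠ v → Precedes w v u := by
  obtain ⟨v, hv, hmin⟩ := U.exists_min_image (fun u => w.idxOf u) hU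
  have hfirst : ∀ u ∈ U, u ≠ v → Precedes w v u := fun u hu huv =>
    (not_precedes_iff (hw.complete u) huv).1 (not_lt.2 (hmin u hu))
  refine ⟨v, ⟨hv, (hw.clique v).subset fun u hu => ?_⟩, hfirst⟩
  obtain ⟨hu, hvu⟩ := mem_nbrsIn.1 hu
  exact ⟨hvu, hfirst u hu hvu.ne'⟩

namespace IsForcedChain

variable {x : V} {U : Finset V} {Y : List V}

theorem mem (h : IsForcedChain G k x U Y) : ∀ y ∈ Y, y ∈ U := by
  induction h with
  | nil => simp
  | cons hU hcard hxy hx hy hall hY ih =>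
    intro v hv
    rcases List.mem_cons.1 hv with rfl | hv
    · exact hy.1
    · exact Finset.mem_of_mem_erase (ih v hv)

theorem nodup (h : IsForcedChain G k x U Y) : Y.Nodup := by
  induction h with
  | nil => simp
  | cons hU hcard hxy hx hy hall hY ih =>
    exact List.nodup_cons.2 ⟨fun hm => by simpa using hY.mem _ hm, ih⟩

theorem notMem (h : IsForcedChain G k x U Y) : x ∉ Y := by
  induction h with
  | nil => simp
  | cons hU hcard hxy hx hy hall hY ih => simp [hxy, ih]

theorem precedes (h : IsForcedChain G k x U Y) {w : List V} (hw : IsEliminationOrdering G w)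
    (i j : ℕ) (hi : i < Y.length) (hj : j < i) (hix : Precedes w Y[i] x) :
    Precedes w Y[j] Y[i] := by
  induction h generalizing i j with
  | nil => simp at hi
  | @cons U y Y hU hcard hxy hx hy hall hY ih =>
    obtain ⟨i, rfl⟩ : ∃ i', i = i' + 1 := ⟨i - 1, by omega⟩
    have hi' : i < Y.length := by simpa using hi
    have hiU : Y[i] ∈ U.erase y := hY.mem _ (List.getElem_mem hi')
    cases j with
    | succ j => exact ih i j hi' (by omega) hix
    | zero =>
      obtain ⟨v, hv, hfirst⟩ := hw.exists_first ⟨x, hx.1⟩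
      rcases hall v hv with rfl | rfl
      · refine absurd (hfirst Y[i] (Finset.mem_of_mem_erase hiU) hix.ne) hix.asymm
      · exact hfirst Y[i] (Finset.mem_of_mem_erase hiU) (Finset.ne_of_mem_erase hiU)

/-- Let `Y[i]` be the last entry of `Y` before `x` in an elimination ordering, and let `z` be a
neighbour of `Y[i]` between `Y[i]` and `x`. Then all later neighbours of `z` other than `x` are
neighbours of `Y[i]`, so that `z` may still be eliminated at its place after `x` and `Y[i]` have
been swapped. -/
theorem adj_of_between [Fintype V] (h : IsForcedChain G k x U Y) (hG : IsKTree G k)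
    (hsx : IsSimplicialIn G Finset.univ x) {w : List V} (hw : IsEliminationOrdering G w)
    (i : ℕ) (hi : i < Y.length) (hlast : ∀ (j : ℕ) (hj : j < Y.length), Precedes w Y[j] x → j ≤ i)
    (hix : Precedes w Y[i] x) {z v : V} (hiz : Precedes w Y[i] z) (hzx : Precedes w z x)
    (hadj : G.Adj Y[i] z) (hzv : G.Adj z v) (hpzv : Precedes w z v) (hvx : v ≠ x) :
    G.Adj Y[i] v := by
  induction h generalizing i with
  | nil => simp at hi
  | @cons U y Y hU hcard hxy hx hy hall hY ih =>
    cases i with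
    | succ i =>
      refine ih i (by simpa using hi) (fun j hj hjx => ?_) hix hiz hadj
      have := hlast (j + 1) (by simpa using hj) hjx
      omega
    | zero =>
      simp only [List.getElem_cons_zero] at hix hiz hadj ⊢
      obtain ⟨v', hv', hfirst⟩ := hw.exists_first ⟨x, hx.1⟩
      rcases hall v' hv' with rfl | e
      · exact absurd hix (hfirst y hy.1 hxy.symm).asymm
      rw [e] at hfirst
      -- The later neighbours of `y` form a clique with `y` and include its `k` neighbours in `U`.
      have hlater : ∀ u, G.Adj y u → Precedes w y u → u ∈ U := by
        intro u hyu hpu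
        by_contra huU
        have hyN : y ∉ nbrsIn G U y := fun hm => G.irrefl (mem_nbrsIn.1 hm).2
        have huN : u ∉ insert y (nbrsIn G U y) := by
          rw [Finset.mem_insert]
          rintro (e | hm)
          · exact hyu.ne' e
          · exact huU (mem_nbrsIn.1 hm).1
        have hNc : ∀ t ∈ nbrsIn G U y, G.Adj y t ∧ Precedes w y t := fun t ht =>
          ⟨(mem_nbrsIn.1 ht).2, hfirst t (mem_nbrsIn.1 ht).1 (mem_nbrsIn.1 ht).2.ne'⟩
        have hcl : G.IsClique (insert u (insert y (nbrsIn G U y)) : Finset V) := by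
          rw [Finset.coe_insert, Finset.coe_insert]
          refine (hy.2.insert fun t ht _ => (hNc t ht).1).insert fun t ht hne => ?_
          rcases ht with rfl | ht
          · exact hyu.symm
          · exact hw.clique y ⟨hyu, hpu⟩ (hNc t ht) hne
        have := IsKTreeOn.card_le_of_isClique hG (Finset.subset_univ _) hcl
        rw [Finset.card_insert_of_notMem huN, Finset.card_insert_of_notMem hyN,
          hU.card_nbrsIn hy] at this
        omega
      have hzU : z ∈ U.erase y := Finset.mem_erase.2 ⟨hadj.ne', hlater z hadj hiz⟩
      cases hY with
      | cons hU' hcard' hxy' hx' hy' hall' hY' =>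
        rename_i y' Y'
        -- No entry of `Y` after `y` precedes `x`, so `x` comes first in what remains of `U`.
        exfalso
        obtain ⟨v', hv', hfirst'⟩ := hw.exists_first ⟨x, hx'.1⟩
        rcases hall' v' hv' with rfl | rfl
        · exact hzx.asymm (hfirst' z hzU hzx.ne)
        · have := hlast 1 (by simp) (hfirst' x hx'.1 hxy')
          omega
      | nil hC hxC =>
        -- Only the clique `U.erase y` around `x` remains; apart from `x` it consists of the
        -- neighbours of `y`.
        have hNx : (U.erase y).erase x = nbrsIn G Finset.univ x := by
          refine Finset.eq_of_subset_of_card_le (fun t ht => ?_) ?_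
          · obtain ⟨htx, ht⟩ := Finset.mem_erase.1 ht
            exact mem_nbrsIn.2 ⟨Finset.mem_univ _, hC.isClique hxC ht htx.symm⟩
          · rw [IsKTreeOn.card_nbrsIn hG hsx, Finset.card_erase_of_mem hxC, hC.card_eq]
            rfl
        have hNy : nbrsIn G U y = (U.erase y).erase x := by
          refine Finset.eq_of_subset_of_card_le (fun t ht => ?_) ?_
          · obtain ⟨htU, hyt⟩ := mem_nbrsIn.1 ht
            refine Finset.mem_erase.2 ⟨?_, Finset.mem_erase.2 ⟨hyt.ne', htU⟩⟩
            rintro rfl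
            exact hU.not_adj hcard hy hx hyt
          · rw [hU.card_nbrsIn hy, Finset.card_erase_of_mem hxC, hC.card_eq]
            rfl
        have hzx' : G.Adj z x := hC.isClique hzU hxC hzx.ne
        have hxv : G.Adj x v := hw.clique z ⟨hzx', hzx⟩ ⟨hzv, hpzv⟩ hvx.symm
        have hv : v ∈ nbrsIn G U y := by
          rw [hNy, hNx]
          exact mem_nbrsIn.2 ⟨Finset.mem_univ _, hxv⟩
        exact (mem_nbrsIn.1 hv).2

end IsForcedChain

/-- Exchanging `x` with an earlier vertex `u` in an elimination ordering only affects the later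
neighbours of the vertices from `u` to `x`. -/
theorem IsEliminationOrdering.map_swap {w : List V} (hw : IsEliminationOrdering G w) {x u : V}
    (hx : G.IsClique (G.neighborSet x)) (hux : Precedes w u x)
    (hadj : ∀ z v, Precedes w u z → Precedes w z x → G.Adj u z → G.Adj z v → Precedes w z v →
      v ≠ x → G.Adj u v) :
    IsEliminationOrdering G (w.map (Equiv.swap x u)) := by
  refine ⟨hw.nodup.map (Equiv.injective _), fun v => ?_, fun z => ?_⟩
  · exact List.mem_map.2 ⟨Equiv.swap x u v, hw.complete _, Equiv.swap_apply_self _ _ _⟩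
  · by_cases hzx : z = x
    · subst hzx
      exact hx.subset fun v hv => hv.1
    -- The later neighbours of `z` after the swap are the old ones, except possibly `u`.
    have hold : ∀ v, G.Adj z v → Precedes (w.map (Equiv.swap x u)) z v →
        (v ≠ u → Precedes w z v) ∧ (v = u → Precedes w z x) ∧
        (v = x → Precedes w z u) := by
      intro v hzv hp
      rw [precedes_map_swap] at hp
      by_cases hzu : z = u
      · subst hzu
        rw [Equiv.swap_apply_right] at hp
        refine ⟨fun _ => ?_, fun e => absurd e hzv.ne', fun e => ?_⟩
        · by_cases hvx : v = x
          · exact hvx ▸ hux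
          · rw [Equiv.swap_apply_of_ne_of_ne hvx hzv.ne'] at hp
            exact hux.trans hp
        · subst e
          rw [Equiv.swap_apply_left] at hp
          exact absurd hp hux.asymm
      · rw [Equiv.swap_apply_of_ne_of_ne hzx hzu] at hp
        refine ⟨fun hvu => ?_, fun e => ?_, fun e => ?_⟩
        · by_cases hvx : v = x
          · subst hvx
            rw [Equiv.swap_apply_left] at hp
            exact hp.trans hux
          · rwa [Equiv.swap_apply_of_ne_of_ne hvx hvu] at hp
        · rwa [e, Equiv.swap_apply_right] at hp
        · rwa [e, Equiv.swap_apply_left] at hp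
    -- If `u` becomes a later neighbour of `z`, its other later neighbours are adjacent to `u`.
    have hu : ∀ v, G.Adj z v → Precedes (w.map (Equiv.swap x u)) z v → G.Adj z u →
        Precedes (w.map (Equiv.swap x u)) z u → v ≠ u → G.Adj u v := by
      intro v hzv hpv hzu hpu hvu
      have h1 := (hold v hzv hpv).1 hvu
      have h2 := (hold u hzu hpu).2.1 rfl
      by_cases hzu' : Precedes w z u
      · exact hw.clique z ⟨hzu, hzu'⟩ ⟨hzv, h1⟩ hvu.symm
      · have h3 := (not_precedes_iff (hw.complete z) hzu.ne).1 hzu'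
        refine hadj z v h3 h2 hzu.symm hzv h1 ?_
        intro e
        exact hzu' ((hold v hzv hpv).2.2 e)
    rintro a ⟨hza, hpa⟩ b ⟨hzb, hpb⟩ hab
    by_cases hau : a = u
    · subst hau
      exact hu b hzb hpb hza hpa hab.symm
    by_cases hbu : b = u
    · subst hbu
      exact (hu a hza hpa hzb hpb hab).symm
    exact hw.clique z ⟨hza, (hold a hza hpa).1 hau⟩ ⟨hzb, (hold b hzb hpb).1 hbu⟩ hab

end Chains

/-! ### The double ladder of a `k`-tree -/

section DoubleLadder

variable {V : Type*} [Fintype V] [DecidableEq V] {G : SimpleGraph V} {k : ℕ}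

theorem elements_eliminationAntimatroid (h : ∃ w, IsEliminationOrdering G w) :
    (eliminationAntimatroid G).elements = Finset.univ := by
  obtain ⟨w, hw⟩ := h
  have hw' := (Finset.mem_filter.1 (mem_basicWords_eliminationAntimatroid.2 hw)).1
  rw [← (mem_orderings.1 hw').2]
  exact Finset.eq_univ_iff_forall.2 fun v => List.mem_toFinset.2 (hw.complete v)

theorem IsForcedChain.isLadder {x : V} {U : Finset V} {Y : List V}
    (h : IsForcedChain G k x U Y) (hG : IsKTree G k) (hx : IsSimplicialIn G Finset.univ x) :
    IsLadder Finset.univ (eliminationAntimatroid G).basicWords x Y where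
  mem := Finset.mem_univ x
  subset y _ := Finset.mem_univ y
  nodup := h.nodup
  notMem := h.notMem
  inOrder w hw i j hi hj hix :=
    h.precedes (mem_basicWords_eliminationAntimatroid.1 hw) i j hi hj hix
  swap w hw i hi hix hlast := by
    rw [mem_basicWords_eliminationAntimatroid] at hw ⊢
    exact hw.map_swap hx.isClique_neighborSet hix fun z v hiz hzx hadj hzv hpzv hvx =>
      h.adj_of_between hG hx hw i hi hlast hix hiz hzx hadj hzv hpzv hvx

/-- In a complete graph every ordering is an elimination ordering. -/
theorem isLadder_singleton_of_isClique (h : G.IsClique Set.univ) {x y : V} (hxy : x ≠ y) :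
    IsLadder Finset.univ (eliminationAntimatroid G).basicWords x [y] where
  mem := Finset.mem_univ x
  subset y _ := Finset.mem_univ y
  nodup := List.nodup_singleton y
  notMem := by simpa using hxy
  inOrder w hw i j hi hj := by
    rw [List.length_singleton] at hi
    omega
  swap w hw i hi hix hlast := by
    rw [mem_basicWords_eliminationAntimatroid] at hw ⊢
    exact hw.map_swap (h.subset (Set.subset_univ _)) hix fun z v hiz _ _ _ hpzv _ =>
      h (Set.mem_univ _) (Set.mem_univ _) (hiz.trans hpzv).ne

theorem IsKTree.hasDoubleLadder (hG : IsKTree G k) (hk : 1 ≤ k) :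
    HasDoubleLadder Finset.univ (eliminationAntimatroid G).basicWords := by
  rcases (IsKTreeOn.lt_card hG).eq_or_lt with hcard | hcard
  · have hcl : G.IsClique Set.univ := by
      simpa using IsKTreeOn.isClique_of_card hG hcard.symm
    obtain ⟨x, -, y, -, hxy⟩ := Finset.one_lt_card.1
      (show 1 < (Finset.univ : Finset V).card by omega)
    exact ⟨x, y, [], [], isLadder_singleton_of_isClique hcl hxy,
      isLadder_singleton_of_isClique hcl hxy.symm⟩
  · obtain ⟨x, y, hxy, hx, hy⟩ := IsKTreeOn.exists_isSimplicialIn hG hcard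
    obtain ⟨U, hU, hUcard, hxU, hyU, hall⟩ :=
      IsKTreeOn.exists_forall_isSimplicialIn hG hxy (IsKTreeOn.not_adj hG hcard hx hy) hx hy
    obtain ⟨Y, hY⟩ := hU.exists_isForcedChain hUcard hxy hxU hyU hall
    obtain ⟨X, hX⟩ := hU.exists_isForcedChain hUcard hxy.symm hyU hxU fun v hv => (hall v hv).symm
    exact ⟨x, y, X, Y, hY.isLadder hG hx, hX.isLadder hG hy⟩

end DoubleLadder

theorem mainTheorem6 {V : Type*} [Fintype V] [DecidableEq V] (G : SimpleGraph V)
    (k : ℕ) (hk : 1 ≤ k) (hG : IsKTree G k) :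
    HasDoubleLadder (eliminationAntimatroid G).elements (eliminationAntimatroid G).basicWords ∧
    HasBalancedPair (eliminationAntimatroid G).elements (eliminationAntimatroid G).basicWords ∧
    (eliminationAntimatroid G).IsBalanced := by
  have hex := hG.exists_isEliminationOrdering
  have hL : HasDoubleLadder (eliminationAntimatroid G).elements
      (eliminationAntimatroid G).basicWords := by
    rw [elements_eliminationAntimatroid hex]
    exact hG.hasDoubleLadder hk
  have hB := hL.hasBalancedPair (Finset.filter_subset _ _)
    (hex.imp fun _ => mem_basicWords_eliminationAntimatroid.2)
  exact ⟨hL, hB, Or.inl hB⟩
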